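/- Let $p,q$ be real numbers with $1<q<p<\infty$, let $\ell_p,\ell_q$ be the real sequence spaces with their usual norms, and let $\mathbb X=\mathbb B(\ell_p,\ell_q)$ be the space of all bounded linear operators from $\ell_p$ to $\ell_q$ with the operator norm. Then for every $T\in\mathbb X$ the following are equivalent: (i) the norm of $\mathbb X$ is Gâteaux differentiable at $T$, i.e. the limit $\lim_{h\to 0}\frac{\|T+hA\|-\|T\|}{h}$ (with $h$ real, $h\neq 0$) exists for every $A\in\mathbb X$; (ii) the norm of $\mathbb X$ is Fréchet differentiable at $T$, i.e. the limit $\lim_{h\to 0}\frac{\|T+hA\|-\|T\|}{h}$ exists uniformly in $A\in\mathbb X$ with $\|A\|=1$. -/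

import Mathlib

open Filter Topology
open scoped ENNReal

/-- The norm of the real normed space `X` is Gâteaux differentiable at `x`:
the limit of `(‖x + h y‖ - ‖x‖) / h` as `h → 0` exists for every direction `y`. -/
def NormGateauxDifferentiableAt {X : Type*} [NormedAddCommGroup X] [NormedSpace ℝ X]
    (x : X) : Prop :=
  ∀ y : X, ∃ l : ℝ, Tendsto (fun h : ℝ => (‖x + h • y‖ - ‖x‖) / h) (𝓝[≠] 0) (𝓝 l)

/-- The norm of the real normed space `X` is Fréchet differentiable at `x`:
the limit of `(‖x + h y‖ - ‖x‖) / h` as `h → 0` exists uniformly in `y` on the unit sphere. -/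
def NormFrechetDifferentiableAt {X : Type*} [NormedAddCommGroup X] [NormedSpace ℝ X]
    (x : X) : Prop :=
  ∃ L : X → ℝ, TendstoUniformlyOn (fun (h : ℝ) (y : X) => (‖x + h • y‖ - ‖x‖) / h) L
    (𝓝[≠] 0) (Metric.sphere (0 : X) 1)

/-!
A norming pair of `T : ℓ_p → ℓ_q` is a pair `(x, g)` of a vector and a functional in the unit balls
with `g (T x) = ‖T‖`, and it yields the support functional `A ↦ g (A x)` of the operator norm at
`T`. By Šmulian's criterion the norm is Fréchet differentiable at `T` if all almost norming pairs
lead to functionals close to one support functional; Gâteaux differentiability says that there is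
only one support functional, so it suffices that almost norming pairs subconverge in norm.

By compactness they subconverge coordinatewise and weak-star, to `(x₀, g₀)` say. The estimate
`‖z + y‖ ^ p ≈ ‖z‖ ^ p + ‖y‖ ^ p` for coordinatewise small `y` gives Pitt's theorem: since `q < p`,
`T` maps bounded coordinatewise null families to norm null ones. Hence `(x₀, g₀)` is norming, and
as `‖x₀‖ = 1` and `g₀` attains its norm, the same estimate upgrades both convergences to norm
convergence.
-/

section Differentiability

variable {X : Type*} [NormedAddCommGroup X] [NormedSpace ℝ X] {x : X} {f : StrongDual ℝ X}

/-- A support functional of the ball of radius `‖x‖` at `x`: a functional of norm at most one that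
attains the norm of `x`. Replacing `v` by `-v` shows that `apply_le_norm` amounts to `‖f‖ ≤ 1`. -/
structure IsSupportFunctional (f : StrongDual ℝ X) (x : X) : Prop where
  apply_self : f x = ‖x‖
  apply_le_norm : ∀ v, f v ≤ ‖v‖

/-- A family of functionals is norming if the norm is its pointwise supremum. Differentiability of
the norm at `x` is tested on the members of such a family that almost attain `‖x‖`. -/
def IsNorming {ι : Type*} (φ : ι → StrongDual ℝ X) : Prop :=
  ∀ v, IsLUB (Set.range fun i => φ i v) ‖v‖

theorem IsSupportFunctional.apply_le_norm_add_sub_norm (hf : IsSupportFunctional f x) (v : X) :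
    f v ≤ ‖x + v‖ - ‖x‖ := by
  have := hf.apply_le_norm (x + v)
  rw [map_add, hf.apply_self] at this
  linarith

theorem IsSupportFunctional.eq_of_tendsto_slope (hf : IsSupportFunctional f x) {y : X} {c : ℝ}
    (hc : Tendsto (fun h : ℝ => (‖x + h • y‖ - ‖x‖) / h) (𝓝[≠] 0) (𝓝 c)) : c = f y := by
  have hderiv : HasDerivAt (fun h : ℝ => ‖x + h • y‖ - h * f y) (c - f y) 0 := by
    refine HasDerivAt.sub (hasDerivAt_iff_tendsto_slope_zero.2 ?_) (hasDerivAt_mul_const (f y))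
    simpa [div_eq_inv_mul] using hc
  have hmin : IsLocalMin (fun h : ℝ => ‖x + h • y‖ - h * f y) 0 := .of_forall fun h => by
    have := hf.apply_le_norm_add_sub_norm (h • y)
    simp only [map_smul, smul_eq_mul] at this
    simp only [zero_smul, add_zero, zero_mul, sub_zero]
    linarith
  exact sub_eq_zero.1 (hmin.hasDerivAt_eq_zero hderiv)

theorem NormGateauxDifferentiableAt.supportFunctional_unique (hx : NormGateauxDifferentiableAt x)
    {g : StrongDual ℝ X} (hf : IsSupportFunctional f x) (hg : IsSupportFunctional g x) :
    f = g := by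
  ext y
  obtain ⟨c, hc⟩ := hx y
  exact (hf.eq_of_tendsto_slope hc).symm.trans (hg.eq_of_tendsto_slope hc)

theorem NormGateauxDifferentiableAt.subsingleton_of_zero
    (h : NormGateauxDifferentiableAt (0 : X)) : Subsingleton X := by
  refine subsingleton_of_forall_eq 0 fun y => ?_
  obtain ⟨g, hg, hgy⟩ := exists_dual_vector'' ℝ y
  have hg_supp : IsSupportFunctional g 0 :=
    ⟨by simp, fun v => (le_abs_self _).trans (g.le_of_opNorm_le hg v |>.trans_eq (one_mul _))⟩
  have hzero_supp : IsSupportFunctional (0 : StrongDual ℝ X) 0 := ⟨by simp, by simp⟩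
  have hg_zero : g = 0 := h.supportFunctional_unique hg_supp hzero_supp
  simpa [hg_zero] using hgy.symm

theorem NormFrechetDifferentiableAt.normGateauxDifferentiableAt
    (hx : NormFrechetDifferentiableAt x) : NormGateauxDifferentiableAt x := by
  obtain ⟨L, hL⟩ := hx
  intro y
  rcases eq_or_ne y 0 with rfl | hy
  · exact ⟨0, by simp⟩
  have hy_pos : 0 < ‖y‖ := norm_pos_iff.2 hy
  have hunit : ‖y‖⁻¹ • y ∈ Metric.sphere (0 : X) 1 := by
    simp [norm_smul, hy_pos.ne']
  have hscale : Tendsto (fun h : ℝ => h * ‖y‖) (𝓝[≠] 0) (𝓝[≠] 0) := by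
    refine tendsto_nhdsWithin_iff.2 ⟨?_, ?_⟩
    · exact ((continuous_mul_const ‖y‖).tendsto' 0 0 (zero_mul _)).mono_left nhdsWithin_le_nhds
    · filter_upwards [self_mem_nhdsWithin] with h hh using mul_ne_zero hh hy_pos.ne'
  refine ⟨‖y‖ * L (‖y‖⁻¹ • y), ?_⟩
  refine (((hL.tendsto_at hunit).comp hscale).const_mul ‖y‖).congr fun h => ?_
  simp only [Function.comp_apply, smul_smul, mul_assoc, mul_inv_cancel₀ hy_pos.ne', mul_one]
  rw [mul_comm h, mul_div_assoc', mul_div_mul_left _ _ hy_pos.ne']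

theorem normFrechetDifferentiableAt_of_differentiableAt (hx : DifferentiableAt ℝ (‖·‖) x) :
    NormFrechetDifferentiableAt x := by
  obtain ⟨f, hf⟩ := hx
  refine ⟨f, Metric.tendstoUniformlyOn_iff.2 fun ε hε => ?_⟩
  have hsmall := Asymptotics.isLittleO_iff.1 (hasFDerivAt_iff_isLittleO_nhds_zero.1 hf)
    (half_pos hε)
  obtain ⟨δ, hδ, hball⟩ := Metric.eventually_nhds_iff.1 hsmall
  filter_upwards [self_mem_nhdsWithin, nhdsWithin_le_nhds (Metric.ball_mem_nhds 0 hδ)]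
    with h (hh : h ≠ 0) hhδ y hy
  have hy : ‖y‖ = 1 := mem_sphere_zero_iff_norm.1 hy
  have hrem := @hball (h • y) (by simpa [norm_smul, hy] using hhδ)
  simp only [map_smul, smul_eq_mul, norm_smul, hy, mul_one, Real.norm_eq_abs] at hrem
  rw [dist_comm, Real.dist_eq, div_sub' hh, abs_div]
  exact ((div_le_iff₀ (abs_pos.2 hh)).2 hrem).trans_lt (half_lt_self hε)

namespace IsNorming

variable {ι : Type*} {φ : ι → StrongDual ℝ X}

theorem apply_le_norm (hφ : IsNorming φ) (i : ι) (v : X) : φ i v ≤ ‖v‖ :=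
  (hφ v).1 ⟨i, rfl⟩

theorem exists_lt_apply (hφ : IsNorming φ) {v : X} {a : ℝ} (ha : a < ‖v‖) : ∃ i, a < φ i v := by
  simpa using (lt_isLUB_iff (hφ v)).1 ha

theorem neBot_comap (hφ : IsNorming φ) (x : X) : (comap (fun i => φ i x) (𝓝 ‖x‖)).NeBot := by
  refine comap_neBot_iff.2 fun s hs => ?_
  obtain ⟨a, ha, has⟩ := exists_Ioc_subset_of_mem_nhds hs (exists_lt ‖x‖)
  obtain ⟨i, hi⟩ := hφ.exists_lt_apply ha
  exact ⟨i, has ⟨hi, hφ.apply_le_norm i x⟩⟩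

theorem isSupportFunctional_of_tendsto (hφ : IsNorming φ) {l : Filter ι} [l.NeBot]
    (hx : Tendsto (fun i => φ i x) l (𝓝 ‖x‖)) (hf : Tendsto φ l (𝓝 f)) :
    IsSupportFunctional f x where
  apply_self := tendsto_nhds_unique (((continuous_eval_const x).tendsto f).comp hf) hx
  apply_le_norm v :=
    le_of_tendsto' (((continuous_eval_const v).tendsto f).comp hf) fun i => hφ.apply_le_norm i v

theorem exists_forall_norm_sub_lt (hφ : IsNorming φ)
    (hf : Tendsto φ (comap (fun i => φ i x) (𝓝 ‖x‖)) (𝓝 f)) {ε : ℝ} (hε : 0 < ε) :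
    ∃ δ > 0, ∀ i, ‖x‖ - δ < φ i x → ‖φ i - f‖ < ε := by
  obtain ⟨δ, hδ, hsub⟩ := ((Metric.nhds_basis_ball.comap _).tendsto_iff
    Metric.nhds_basis_ball).1 hf ε hε
  refine ⟨δ, hδ, fun i hi => ?_⟩
  have hmem : φ i x ∈ Metric.ball ‖x‖ δ := by
    rw [Metric.mem_ball, Real.dist_eq, abs_sub_lt_iff]
    constructor <;> linarith [hφ.apply_le_norm i x]
  simpa only [Metric.mem_ball, dist_eq_norm] using hsub i hmem

/-- One half of Šmulian's criterion: a functional that almost norms `x + v` almost norms `x`, so it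
is close to `f`. -/
theorem hasFDerivAt_norm (hφ : IsNorming φ)
    (hf : Tendsto φ (comap (fun i => φ i x) (𝓝 ‖x‖)) (𝓝 f)) : HasFDerivAt (‖·‖) f x := by
  have := hφ.neBot_comap x
  have hsupp : IsSupportFunctional f x := hφ.isSupportFunctional_of_tendsto tendsto_comap hf
  rw [hasFDerivAt_iff_isLittleO_nhds_zero, Asymptotics.isLittleO_iff]
  intro ε hε
  obtain ⟨δ, hδ, hclose⟩ := hφ.exists_forall_norm_sub_lt hf (half_pos hε)
  have hpos : 0 < δ / (2 + ε / 2) := by positivity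
  filter_upwards [Metric.ball_mem_nhds 0 hpos] with v hv
  rw [mem_ball_zero_iff, lt_div_iff₀ (by positivity)] at hv
  rcases eq_or_ne v 0 with rfl | hv_ne
  · simp
  obtain ⟨i, hi⟩ := hφ.exists_lt_apply (v := x + v) (a := ‖x + v‖ - ε / 2 * ‖v‖)
    (sub_lt_self _ (mul_pos (half_pos hε) (norm_pos_iff.2 hv_ne)))
  rw [map_add] at hi
  have htri : ‖x‖ ≤ ‖x + v‖ + ‖v‖ := by simpa using norm_sub_le (x + v) v
  have hdiff : φ i v - f v ≤ ε / 2 * ‖v‖ :=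
    (le_abs_self _).trans ((φ i - f).le_of_opNorm_le
      (hclose i (by linarith [hφ.apply_le_norm i v])).le v)
  rw [Real.norm_eq_abs, abs_of_nonneg (by linarith [hsupp.apply_le_norm_add_sub_norm v])]
  linarith [hφ.apply_le_norm i x]

theorem differentiableAt_norm_of_ultrafilter (hφ : IsNorming φ) (hx : NormGateauxDifferentiableAt x)
    (hconv : ∀ l : Ultrafilter ι, Tendsto (fun i => φ i x) l (𝓝 ‖x‖) →
      ∃ f, Tendsto φ l (𝓝 f)) :
    DifferentiableAt ℝ (‖·‖) x := by
  have := hφ.neBot_comap x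
  have hlim : ∀ l : Ultrafilter ι, (l : Filter ι) ≤ comap (fun i => φ i x) (𝓝 ‖x‖) →
      ∃ f, Tendsto φ l (𝓝 f) ∧ IsSupportFunctional f x := fun l hl => by
    have hlx := tendsto_iff_comap.2 hl
    obtain ⟨f, hf⟩ := hconv l hlx
    exact ⟨f, hf, hφ.isSupportFunctional_of_tendsto hlx hf⟩
  obtain ⟨f, -, hf⟩ := hlim _ (Ultrafilter.of_le _)
  refine ⟨f, hφ.hasFDerivAt_norm ((tendsto_iff_ultrafilter _ _ _).2 fun l hl => ?_)⟩
  obtain ⟨g, hg_lim, hg⟩ := hlim l hl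
  rwa [hx.supportFunctional_unique hf hg]

end IsNorming

end Differentiability

section Operators

variable {X Y : Type*} [NormedAddCommGroup X] [NormedSpace ℝ X] [NormedAddCommGroup Y]
  [NormedSpace ℝ Y]

theorem exists_norm_le_one_opNorm_rpow_sub_lt (T : X →L[ℝ] Y) {r ε : ℝ} (hr : 0 < r)
    (hε : 0 < ε) : ∃ z, ‖z‖ ≤ 1 ∧ ‖T‖ ^ r - ε < ‖T z‖ ^ r := by
  by_contra! h
  have hnonneg : 0 ≤ ‖T‖ ^ r - ε := by simpa [hr.ne'] using h 0 (by simp)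
  have hbound : ‖T‖ ≤ (‖T‖ ^ r - ε) ^ r⁻¹ :=
    T.opNorm_le_of_unit_norm (by positivity) fun z hz =>
      (Real.le_rpow_inv_iff_of_pos (norm_nonneg _) hnonneg hr).2 (h z hz.le)
  rw [Real.le_rpow_inv_iff_of_pos (norm_nonneg _) hnonneg hr] at hbound
  linarith

theorem exists_norm_le_one_opNorm_le_two_mul (T : X →L[ℝ] Y) :
    ∃ z, ‖z‖ ≤ 1 ∧ ‖T‖ ≤ 2 * ‖T z‖ := by
  rcases eq_or_ne T 0 with rfl | hT
  · exact ⟨0, by simp⟩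
  obtain ⟨z, hz, hTz⟩ := T.exists_lt_apply_of_lt_opNorm (half_lt_self (norm_pos_iff.2 hT))
  exact ⟨z, hz.le, by linarith⟩

/-- The functional `A ↦ g (A x)` on operators given by a pair `w = (x, g)`; the pairs in the unit
ball give a norming family for the operator norm. -/
noncomputable def pairingFunctional (w : X × StrongDual ℝ Y) : StrongDual ℝ (X →L[ℝ] Y) :=
  w.2.comp (ContinuousLinearMap.apply ℝ Y w.1)

theorem continuous_pairingFunctional :
    Continuous (pairingFunctional : X × StrongDual ℝ Y → StrongDual ℝ (X →L[ℝ] Y)) :=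
  continuous_snd.clm_comp ((ContinuousLinearMap.apply ℝ Y).continuous.comp continuous_fst)

theorem isNorming_pairingFunctional :
    IsNorming fun w : Metric.closedBall (0 : X × StrongDual ℝ Y) 1 => pairingFunctional w.1 := by
  refine fun A => ⟨?_, fun c hc => ?_⟩
  · rintro _ ⟨⟨⟨x, g⟩, hw⟩, rfl⟩
    obtain ⟨hx, hg⟩ : ‖x‖ ≤ 1 ∧ ‖g‖ ≤ 1 := by simpa [Prod.norm_def] using hw
    calc g (A x) ≤ ‖g (A x)‖ := le_abs_self _
      _ ≤ 1 * (‖A‖ * 1) := g.le_of_opNorm_le_of_le hg (A.le_of_opNorm_le_of_le le_rfl hx)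
      _ = ‖A‖ := by ring
  · have hunit : ∀ x, ‖x‖ ≤ 1 → ‖A x‖ ≤ c := fun x hx => by
      obtain ⟨g, hg, hgx⟩ := exists_dual_vector'' ℝ (A x)
      exact hgx.ge.trans (hc ⟨⟨(x, g), by simpa [Prod.norm_def] using ⟨hx, hg⟩⟩, rfl⟩)
    exact A.opNorm_le_of_unit_norm ((norm_nonneg _).trans (hunit 0 (by simp))) fun x hx =>
      hunit x hx.le

theorem differentiableAt_opNorm_of_ultrafilter {T : X →L[ℝ] Y} (hT : NormGateauxDifferentiableAt T)
    (hconv : ∀ l : Ultrafilter (Metric.closedBall (0 : X × StrongDual ℝ Y) 1),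
      Tendsto (fun w : Metric.closedBall (0 : X × StrongDual ℝ Y) 1 => w.1.2 (T w.1.1)) l (𝓝 ‖T‖) →
        ∃ w₀, Tendsto (fun w : Metric.closedBall (0 : X × StrongDual ℝ Y) 1 => w.1) l (𝓝 w₀)) :
    DifferentiableAt ℝ (‖·‖) T := by
  refine isNorming_pairingFunctional.differentiableAt_norm_of_ultrafilter hT fun l hl => ?_
  obtain ⟨w₀, hw₀⟩ := hconv l hl
  exact ⟨pairingFunctional w₀, (continuous_pairingFunctional.tendsto w₀).comp hw₀⟩

end Operators

theorem exists_tendsto_of_isCompact {ι X : Type*} [TopologicalSpace X] {K : Set X}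
    (hK : IsCompact K) (l : Ultrafilter ι) {u : ι → X} (hu : ∀ n, u n ∈ K) :
    ∃ a ∈ K, Tendsto u l (𝓝 a) :=
  hK.ultrafilter_le_nhds' (l.map u) (Ultrafilter.mem_map.2 (univ_mem' hu))

theorem exists_tendsto_apply_of_norm_le {ι X : Type*} [NormedAddCommGroup X] [NormedSpace ℝ X]
    (l : Ultrafilter ι) {g : ι → StrongDual ℝ X} {C : ℝ} (hg : ∀ n, ‖g n‖ ≤ C) :
    ∃ g₀ : StrongDual ℝ X, ‖g₀‖ ≤ C ∧ ∀ z, Tendsto (fun n => g n z) l (𝓝 (g₀ z)) := by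
  obtain ⟨g₀, hg₀, hlim⟩ := exists_tendsto_of_isCompact
    (WeakDual.isCompact_closedBall (𝕜 := ℝ) (E := X) 0 C) l
    (u := fun n => StrongDual.toWeakDual (g n)) fun n => mem_closedBall_zero_iff.2 (hg n)
  exact ⟨WeakDual.toStrongDual g₀, mem_closedBall_zero_iff.1 hg₀, fun z =>
    (WeakDual.eval_continuous z).continuousAt.tendsto.comp hlim⟩

/-- Dividing by `t ^ r` and letting `t → 0` gives the conclusion, since `r < s`. -/
theorem tendsto_zero_of_rpow_mul_le {ι : Type*} {l : Filter ι} {b : ι → ℝ} {r s K : ℝ}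
    (hrs : r < s) (hb : ∀ n, 0 ≤ b n)
    (h : ∀ t > 0, ∀ ε > 0, ∀ᶠ n in l, t ^ r * b n ≤ K * t ^ s + ε) : Tendsto b l (𝓝 0) := by
  have hlim : Tendsto (fun t : ℝ => K * t ^ (s - r)) (𝓝[>] 0) (𝓝 0) := by
    have := (Real.continuousAt_rpow_const 0 (s - r) (.inr (sub_pos.2 hrs).le)).tendsto.const_mul K
    rw [Real.zero_rpow (sub_pos.2 hrs).ne', mul_zero] at this
    exact this.mono_left nhdsWithin_le_nhds
  refine tendsto_order.2 ⟨fun a ha => .of_forall fun n => ha.trans_le (hb n), fun δ hδ => ?_⟩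
  obtain ⟨t, htδ, ht⟩ : ∃ t, K * t ^ (s - r) < δ / 2 ∧ 0 < t :=
    ((hlim.eventually_lt_const (half_pos hδ)).and self_mem_nhdsWithin).exists
  have htr : 0 < t ^ r := Real.rpow_pos_of_pos ht r
  filter_upwards [h t ht (t ^ r * (δ / 2)) (by positivity)] with n hn
  refine lt_of_mul_lt_mul_left (hn.trans_lt ?_) htr.le
  calc K * t ^ s + t ^ r * (δ / 2) = t ^ r * (K * t ^ (s - r) + δ / 2) := by
        rw [Real.rpow_sub ht]; field_simp
    _ < t ^ r * δ := by gcongr; linarith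

theorem one_le_toReal {p : ℝ≥0∞} [Fact (1 ≤ p)] (hp : p ≠ ∞) : 1 ≤ p.toReal := by
  simpa using ENNReal.toReal_mono hp (Fact.out : 1 ≤ p)

theorem uniformContinuousOn_norm_rpow {X : Type*} [SeminormedAddCommGroup X] {r : ℝ} (hr : 0 ≤ r)
    (R : ℝ) : UniformContinuousOn (fun z : X => ‖z‖ ^ r) (Metric.closedBall 0 R) :=
  (isCompact_Icc.uniformContinuousOn_of_continuous
    (Real.continuous_rpow_const hr).continuousOn).comp uniformContinuous_norm.uniformContinuousOn
    fun z hz => Set.mem_Icc.2 ⟨norm_nonneg z, mem_closedBall_zero_iff.1 hz⟩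

section SequenceSpaces

variable {α : Type*} {E : α → Type*} [∀ i, NormedAddCommGroup (E i)] {p : ℝ≥0∞} [Fact (1 ≤ p)]
  {ι : Type*} {l : Filter ι} {x : lp E p} {y : ι → lp E p} {C : ℝ}

theorem tendsto_norm_add_rpow_sub_of_finite_support (hp : p ≠ ∞) {s : Finset α}
    (hx : ∀ i ∉ s, x i = 0) (hy : ∀ i, Tendsto (fun n => y n i) l (𝓝 0)) :
    Tendsto (fun n => ‖x + y n‖ ^ p.toReal - ‖x‖ ^ p.toReal - ‖y n‖ ^ p.toReal) l (𝓝 0) := by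
  have hr : 0 < p.toReal := zero_lt_one.trans_le (one_le_toReal hp)
  let G : ι → α → ℝ := fun n i =>
    ‖x i + y n i‖ ^ p.toReal - ‖x i‖ ^ p.toReal - ‖y n i‖ ^ p.toReal
  have hsum : ∀ n, ‖x + y n‖ ^ p.toReal - ‖x‖ ^ p.toReal - ‖y n‖ ^ p.toReal = ∑ i ∈ s, G n i := by
    intro n
    refine (((lp.hasSum_norm hr (x + y n)).sub (lp.hasSum_norm hr x)).sub
      (lp.hasSum_norm hr (y n))).unique (hasSum_sum_of_ne_finset_zero fun i hi => ?_)
    simp [hx i hi, hr.ne']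
  have hcoord : ∀ i, Tendsto (fun n => G n i) l (𝓝 0) := fun i => by
    have hadd := ((hy i).const_add (x i)).norm.rpow_const (p := p.toReal) (.inr hr.le)
    simpa [hr.ne'] using (hadd.sub_const (‖x i‖ ^ p.toReal)).sub
      ((hy i).norm.rpow_const (.inr hr.le))
  simpa [hsum] using tendsto_finsetSum s fun i _ => hcoord i

/-- The Brezis–Lieb lemma in `ℓ_p`. For bounded `y` the expression is continuous in `x`,
uniformly in `n`, so it suffices to treat the finitely supported truncations of `x`. -/
theorem tendsto_norm_add_rpow_sub (hp : p ≠ ∞) (x : lp E p) (hyC : ∀ n, ‖y n‖ ≤ C)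
    (hy : ∀ i, Tendsto (fun n => y n i) l (𝓝 0)) :
    Tendsto (fun n => ‖x + y n‖ ^ p.toReal - ‖x‖ ^ p.toReal - ‖y n‖ ^ p.toReal) l (𝓝 0) := by
  classical
  have hr : 0 < p.toReal := zero_lt_one.trans_le (one_le_toReal hp)
  let a : Finset α → lp E p := fun s => ∑ i ∈ s, lp.single p i (x i)
  let F : lp E p → ι → ℝ := fun z n => ‖z + y n‖ ^ p.toReal - ‖z‖ ^ p.toReal - ‖y n‖ ^ p.toReal
  have ha : Tendsto a atTop (𝓝 x) := lp.hasSum_single hp x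
  have ha_lim : ∀ s, Tendsto (F (a s)) l (𝓝 0) := fun s =>
    tendsto_norm_add_rpow_sub_of_finite_support hp (s := s) (fun i hi => by
      simp only [a, lp.coeFn_sum, Finset.sum_apply, lp.coeFn_single, Finset.sum_pi_single, hi,
        if_false]) hy
  have hunif : TendstoUniformly (fun s => F (a s)) (F x) atTop := by
    refine Metric.tendstoUniformly_iff.2 fun ε hε => ?_
    obtain ⟨δ, hδ, hclose⟩ := Metric.uniformContinuousOn_iff.1
      (uniformContinuousOn_norm_rpow (X := lp E p) hr.le (‖x‖ + 1 + max C 0)) (ε / 2) (half_pos hε)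
    filter_upwards [ha (Metric.ball_mem_nhds x (lt_min hδ one_pos))] with s hs n
    have hdist : dist x (a s) < min δ 1 := by simpa [dist_comm] using hs
    have has : ‖a s‖ ≤ ‖x‖ + 1 := by
      linarith [norm_le_norm_add_norm_sub x (a s), dist_eq_norm x (a s), min_le_right δ 1]
    have hstep : ∀ w, ‖w‖ ≤ max C 0 →
        dist (‖x + w‖ ^ p.toReal) (‖a s + w‖ ^ p.toReal) < ε / 2 := fun w hw =>
      hclose _ (mem_closedBall_zero_iff.2 <| by linarith [norm_add_le x w]) _
        (mem_closedBall_zero_iff.2 <| by linarith [norm_add_le (a s) w])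
        ((dist_add_right x (a s) w).trans_lt (hdist.trans_le (min_le_left _ _)))
    have hzero := hstep 0 (by simp)
    have hyn := hstep (y n) ((hyC n).trans (le_max_left _ _))
    simp only [add_zero, Real.dist_eq, abs_lt] at hzero hyn
    simp only [F, Real.dist_eq, abs_lt]
    constructor <;> linarith
  exact hunif.tendsto_of_eventually_tendsto (.of_forall ha_lim) tendsto_const_nhds

end SequenceSpaces

section Perturbation

variable {α β : Type*} {E : α → Type*} {F : β → Type*} [∀ i, NormedAddCommGroup (E i)]
  [∀ i, NormedSpace ℝ (E i)] [∀ i, NormedAddCommGroup (F i)] [∀ i, NormedSpace ℝ (F i)]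
  {p q : ℝ≥0∞} [Fact (1 ≤ p)] [Fact (1 ≤ q)]
  {ι : Type*} {l : Filter ι} {y : ι → lp E p} {C : ℝ}

theorem tendsto_norm_add_smul_rpow_sub (hp : p ≠ ∞) (z : lp E p) (hyC : ∀ n, ‖y n‖ ≤ C)
    (hy : ∀ i, Tendsto (fun n => y n i) l (𝓝 0)) (c : ℝ) :
    Tendsto (fun n => ‖z + c • y n‖ ^ p.toReal - ‖z‖ ^ p.toReal - (|c| * ‖y n‖) ^ p.toReal) l
      (𝓝 0) := by
  simpa only [norm_smul, Real.norm_eq_abs] using tendsto_norm_add_rpow_sub hp z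
    (fun n => (norm_smul_le c (y n)).trans (mul_le_mul_of_nonneg_left (hyC n) (norm_nonneg c)))
    fun i => by simpa using (hy i).const_smul c

theorem eventually_norm_add_smul_rpow_le (hp : p ≠ ∞) {r : ℝ} (hr : 0 ≤ r) (hrp : r ≤ p.toReal)
    {z : lp E p} (hz : ‖z‖ ≤ 1) (hyC : ∀ n, ‖y n‖ ≤ C)
    (hy : ∀ i, Tendsto (fun n => y n i) l (𝓝 0)) (c : ℝ) {ε : ℝ} (hε : 0 < ε) :
    ∀ᶠ n in l, ‖z + c • y n‖ ^ r ≤ 1 + (|c| * C) ^ p.toReal + ε := by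
  filter_upwards [(tendsto_norm_add_smul_rpow_sub hp z hyC hy c).eventually_lt_const hε] with n hn
  have hC : 0 ≤ C := (norm_nonneg _).trans (hyC n)
  rcases le_total ‖z + c • y n‖ 1 with hle | hge
  · have : 0 ≤ (|c| * C) ^ p.toReal := by positivity
    linarith [Real.rpow_le_one (norm_nonneg _) hle hr]
  · have hz_pow : ‖z‖ ^ p.toReal ≤ 1 := Real.rpow_le_one (norm_nonneg _) hz (hr.trans hrp)
    have hy_pow : (|c| * ‖y n‖) ^ p.toReal ≤ (|c| * C) ^ p.toReal := by
      gcongr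
      exact hyC n
    linarith [Real.rpow_le_rpow_of_exponent_le hge hrp]

/-- Test `g n` on `z ± t • y n`: the gain `t * |g n (y n)|` over the almost maximal value `g n z` is
linear in `t`, whereas the norm of the argument exceeds one by only `O(t ^ p)`. -/
theorem tendsto_apply_zero_of_almost_norming (hp₁ : 1 < p) (hp : p ≠ ∞)
    {g : ι → StrongDual ℝ (lp E p)} {M : ℝ} (hg : ∀ n, ‖g n‖ ≤ M)
    (hnorm : ∀ ε > 0, ∃ z, ‖z‖ ≤ 1 ∧ ∀ᶠ n in l, M - ε ≤ g n z) (hyC : ∀ n, ‖y n‖ ≤ C)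
    (hy : ∀ i, Tendsto (fun n => y n i) l (𝓝 0)) : Tendsto (fun n => g n (y n)) l (𝓝 0) := by
  have hp₁' : 1 < p.toReal := by simpa using ENNReal.toReal_strict_mono hp hp₁
  refine (tendsto_zero_iff_abs_tendsto_zero _).2 <| tendsto_zero_of_rpow_mul_le
    (K := M * C ^ p.toReal) hp₁' (fun n => abs_nonneg _) fun t ht ε hε => ?_
  obtain ⟨η, hη, hηε⟩ := exists_pos_mul_lt hε (M + 1)
  obtain ⟨z, hz, hgz⟩ := hnorm η hη
  have hupper : ∀ c : ℝ, |c| = t → ∀ᶠ n in l,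
      g n z + c * g n (y n) ≤ M * (1 + C ^ p.toReal * t ^ p.toReal + η) := fun c hc => by
    filter_upwards [eventually_norm_add_smul_rpow_le hp zero_le_one hp₁'.le hz hyC hy c hη]
      with n hn
    have hC : 0 ≤ C := (norm_nonneg _).trans (hyC n)
    rw [Real.rpow_one, hc, mul_comm t, Real.mul_rpow hC ht.le] at hn
    calc g n z + c * g n (y n) = g n (z + c • y n) := by simp
      _ ≤ ‖g n (z + c • y n)‖ := le_abs_self _
      _ ≤ M * (1 + C ^ p.toReal * t ^ p.toReal + η) := (g n).le_of_opNorm_le_of_le (hg n) hn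
  filter_upwards [hgz, hupper t (abs_of_pos ht), hupper (-t) (by rw [abs_neg, abs_of_pos ht])]
    with n hgz_n hpos hneg
  simp only [Function.comp_apply, Real.rpow_one]
  rcases abs_choice (g n (y n)) with habs | habs <;> rw [habs] <;> linarith

theorem tendsto_strongDual_apply_zero (hp₁ : 1 < p) (hp : p ≠ ∞) (g : StrongDual ℝ (lp E p))
    (hyC : ∀ n, ‖y n‖ ≤ C) (hy : ∀ i, Tendsto (fun n => y n i) l (𝓝 0)) :
    Tendsto (fun n => g (y n)) l (𝓝 0) := by
  refine tendsto_apply_zero_of_almost_norming hp₁ hp (fun _ => le_rfl) (fun ε hε => ?_) hyC hy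
  obtain ⟨z, hz, hgz⟩ := exists_norm_le_one_opNorm_rpow_sub_lt g one_pos hε
  simp only [Real.rpow_one, Real.norm_eq_abs] at hgz
  rcases abs_choice (g z) with habs | habs
  · exact ⟨z, hz, .of_forall fun _ => by linarith⟩
  · exact ⟨-z, by rwa [norm_neg], .of_forall fun _ => by rw [map_neg]; linarith⟩

theorem tendsto_apply_zero_of_finiteDimensional (hp₁ : 1 < p) (hp : p ≠ ∞) {G : Type*}
    [NormedAddCommGroup G] [NormedSpace ℝ G] [FiniteDimensional ℝ G] (T : lp E p →L[ℝ] G)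
    (hyC : ∀ n, ‖y n‖ ≤ C) (hy : ∀ i, Tendsto (fun n => y n i) l (𝓝 0)) :
    Tendsto (fun n => T (y n)) l (𝓝 0) := by
  let b := Module.finBasis ℝ G
  have hweak : ∀ f : StrongDual ℝ G, Tendsto (fun n => f (T (y n))) l (𝓝 0) := fun f =>
    tendsto_strongDual_apply_zero hp₁ hp (f.comp T) hyC hy
  have hcoord : Tendsto (fun n => b.equivFunL (T (y n))) l (𝓝 0) := tendsto_pi_nhds.2 fun j =>
    hweak (LinearMap.toContinuousLinearMap (b.coord j))
  simpa [Function.comp_def] using (b.equivFunL.symm.continuous.tendsto 0).comp hcoord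

theorem tendsto_zero_of_tendsto_norm_rpow {X : Type*} [SeminormedAddCommGroup X] {u : ι → X}
    {r : ℝ} (hr : 0 < r) (hu : Tendsto (fun n => ‖u n‖ ^ r) l (𝓝 0)) : Tendsto u l (𝓝 0) := by
  have := hu.rpow_const (p := r⁻¹) (.inr (inv_nonneg.2 hr.le))
  simp only [Real.rpow_rpow_inv (norm_nonneg _) hr.ne', Real.zero_rpow (inv_ne_zero hr.ne')]
    at this
  exact tendsto_zero_iff_norm_tendsto_zero.2 this

/-- Delpech's argument for Pitt's theorem: if `z` almost norms `T`, then `‖z + t • y n‖ ^ q`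
exceeds one by only `O(t ^ p)`, but its image gains about `t ^ q * ‖T (y n)‖ ^ q`. -/
theorem tendsto_apply_zero_of_exponent_lt (hqp : q < p) (hp : p ≠ ∞)
    [∀ i, FiniteDimensional ℝ (F i)] (T : lp E p →L[ℝ] lp F q) (hyC : ∀ n, ‖y n‖ ≤ C)
    (hy : ∀ i, Tendsto (fun n => y n i) l (𝓝 0)) : Tendsto (fun n => T (y n)) l (𝓝 0) := by
  have hq : q ≠ ∞ := (hqp.trans_le le_top).ne
  have hr : 0 < q.toReal := zero_lt_one.trans_le (one_le_toReal hq)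
  have hrs : q.toReal < p.toReal := ENNReal.toReal_strict_mono hp hqp
  have hTy : ∀ i, Tendsto (fun n => T (y n) i) l (𝓝 0) := fun i =>
    tendsto_apply_zero_of_finiteDimensional ((Fact.out : 1 ≤ q).trans_lt hqp) hp
      ((lp.evalCLM ℝ F q i).comp T) hyC hy
  refine tendsto_zero_of_tendsto_norm_rpow hr <| tendsto_zero_of_rpow_mul_le
    (K := ‖T‖ ^ q.toReal * C ^ p.toReal) hrs (fun n => by positivity) fun t ht ε hε => ?_
  obtain ⟨η, hη, hηε⟩ := exists_pos_mul_lt hε (‖T‖ ^ q.toReal + 2)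
  obtain ⟨z, hz, hTz⟩ := exists_norm_le_one_opNorm_rpow_sub_lt T hr hη
  filter_upwards [eventually_norm_add_smul_rpow_le hp hr.le hrs.le hz hyC hy t hη,
    (tendsto_norm_add_smul_rpow_sub hq (T z) (fun n => T.le_of_opNorm_le_of_le le_rfl (hyC n)) hTy
      t).eventually_const_lt (neg_lt_zero.2 hη)] with n hdom hcod
  have hC : 0 ≤ C := (norm_nonneg _).trans (hyC n)
  rw [abs_of_pos ht, mul_comm t, Real.mul_rpow hC ht.le] at hdom
  rw [abs_of_pos ht, Real.mul_rpow ht.le (norm_nonneg _), ← map_smul, ← map_add] at hcod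
  have hupper : ‖T (z + t • y n)‖ ^ q.toReal ≤
      ‖T‖ ^ q.toReal * (1 + C ^ p.toReal * t ^ p.toReal + η) :=
    calc ‖T (z + t • y n)‖ ^ q.toReal ≤ (‖T‖ * ‖z + t • y n‖) ^ q.toReal := by
          gcongr; exact T.le_opNorm _
      _ = ‖T‖ ^ q.toReal * ‖z + t • y n‖ ^ q.toReal :=
          Real.mul_rpow (norm_nonneg _) (norm_nonneg _)
      _ ≤ _ := by gcongr
  linarith

end Perturbation

section Compactness

variable {α β : Type*} {E : α → Type*} {F : β → Type*} [∀ i, NormedAddCommGroup (E i)]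
  [∀ i, NormedAddCommGroup (F i)] {p q : ℝ≥0∞} [Fact (1 ≤ p)] [Fact (1 ≤ q)] {ι : Type*}

/-- The Radon–Riesz property of `ℓ_p`. -/
theorem tendsto_zero_of_norm_add_le (hp : p ≠ ∞) {l : Filter ι} {x : lp E p} {y : ι → lp E p}
    (hxy : ∀ n, ‖x + y n‖ ≤ ‖x‖) (hy : ∀ i, Tendsto (fun n => y n i) l (𝓝 0)) :
    Tendsto y l (𝓝 0) := by
  have hr : 0 < p.toReal := zero_lt_one.trans_le (one_le_toReal hp)
  have hyC : ∀ n, ‖y n‖ ≤ ‖x‖ + ‖x‖ := fun n => by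
    simpa using (norm_sub_le (x + y n) x).trans (add_le_add_left (hxy n) _)
  refine tendsto_zero_of_tendsto_norm_rpow hr <| squeeze_zero (fun n => by positivity) (fun n => ?_)
    (by simpa using (tendsto_norm_add_rpow_sub hp x hyC hy).neg)
  linarith [Real.rpow_le_rpow (norm_nonneg _) (hxy n) hr.le]

theorem exists_coordinatewise_limit [∀ i, ProperSpace (E i)] (l : Ultrafilter ι)
    {x : ι → lp E p} {C : ℝ} (hx : ∀ n, ‖x n‖ ≤ C) :
    ∃ a : lp E p, ‖a‖ ≤ C ∧ ∀ i, Tendsto (fun n => (x n - a) i) l (𝓝 0) := by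
  have hp : p ≠ 0 := (zero_lt_one.trans_le Fact.out).ne'
  have hcoord : ∀ i, ∃ c, Tendsto (fun n => x n i) l (𝓝 c) := fun i => by
    obtain ⟨c, -, hc⟩ := exists_tendsto_of_isCompact (isCompact_closedBall (0 : E i) C) l
      (u := fun n => x n i) fun n =>
        mem_closedBall_zero_iff.2 ((lp.norm_apply_le_norm hp (x n) i).trans (hx n))
    exact ⟨c, hc⟩
  choose c hc using hcoord
  have hlim : Tendsto (id fun n => x n : ι → ∀ i, E i) l (𝓝 c) := tendsto_pi_nhds.2 hc
  have hbdd : Bornology.IsBounded (Set.range x) :=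
    isBounded_iff_forall_norm_le.2 ⟨C, Set.forall_mem_range.2 hx⟩
  exact ⟨⟨c, lp.memℓp_of_tendsto hbdd hlim⟩, lp.norm_le_of_tendsto (.of_forall hx) hlim,
    fun i => tendsto_sub_nhds_zero_iff.2 (hc i)⟩

variable [∀ i, NormedSpace ℝ (E i)] [∀ i, NormedSpace ℝ (F i)] [∀ i, FiniteDimensional ℝ (E i)]
  [∀ i, FiniteDimensional ℝ (F i)]

/-- The weak-star Radon–Riesz property of the dual of `ℓ_p`, without identifying that dual: vectors
almost norming `g n - g₀` are split into their coordinatewise limit and a null family. -/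
theorem tendsto_strongDual_of_tendsto_apply (hp₁ : 1 < p) (hp : p ≠ ∞) (l : Ultrafilter ι)
    {g : ι → StrongDual ℝ (lp E p)} {g₀ : StrongDual ℝ (lp E p)} (hg : ∀ n, ‖g n‖ ≤ 1)
    (hlim : ∀ z, Tendsto (fun n => g n z) l (𝓝 (g₀ z))) {z : lp E p} (hz : ‖z‖ ≤ 1)
    (hgz : g₀ z = 1) : Tendsto g l (𝓝 g₀) := by
  have : ∀ i, ProperSpace (E i) := fun i => FiniteDimensional.proper_real (E i)
  choose w hw hgw using fun n => exists_norm_le_one_opNorm_le_two_mul (g n - g₀)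
  obtain ⟨a, ha, hwa⟩ := exists_coordinatewise_limit l hw
  have hwC : ∀ n, ‖w n - a‖ ≤ 1 + 1 := fun n => norm_sub_le_of_le (hw n) ha
  have hg_lim : Tendsto (fun n => g n (w n - a)) l (𝓝 0) :=
    tendsto_apply_zero_of_almost_norming hp₁ hp hg (fun ε hε => ⟨z, hz,
      ((hlim z).eventually_const_lt (by linarith : 1 - ε < g₀ z)).mono fun _ => le_of_lt⟩) hwC hwa
  have hg₀_lim : Tendsto (fun n => g₀ (w n - a)) l (𝓝 0) :=
    tendsto_strongDual_apply_zero hp₁ hp g₀ hwC hwa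
  have hdiff : Tendsto (fun n => (g n - g₀) (w n)) l (𝓝 0) := by
    have := (hg_lim.sub hg₀_lim).add (tendsto_sub_nhds_zero_iff.2 (hlim a))
    simp only [sub_zero, add_zero] at this
    refine this.congr fun n => ?_
    simp only [map_sub, sub_apply]
    ring
  refine tendsto_iff_norm_sub_tendsto_zero.2 (squeeze_zero (fun _ => norm_nonneg _) hgw ?_)
  simpa using hdiff.norm.const_mul 2

theorem exists_tendsto_norming_pair (hq : 1 < q) (hqp : q < p) (hp : p ≠ ∞)
    {T : lp E p →L[ℝ] lp F q} (hT : T ≠ 0) (l : Ultrafilter ι) {x : ι → lp E p}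
    {g : ι → StrongDual ℝ (lp F q)} (hx : ∀ n, ‖x n‖ ≤ 1) (hg : ∀ n, ‖g n‖ ≤ 1)
    (hlim : Tendsto (fun n => g n (T (x n))) l (𝓝 ‖T‖)) :
    ∃ x₀ g₀, Tendsto x l (𝓝 x₀) ∧ Tendsto g l (𝓝 g₀) := by
  have : ∀ i, ProperSpace (E i) := fun i => FiniteDimensional.proper_real (E i)
  have hT_pos : 0 < ‖T‖ := norm_pos_iff.2 hT
  obtain ⟨x₀, hx₀, hx_lim⟩ := exists_coordinatewise_limit l hx
  obtain ⟨g₀, hg₀, hg_lim⟩ := exists_tendsto_apply_of_norm_le l hg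
  have hpitt : Tendsto (fun n => T (x n - x₀)) l (𝓝 0) :=
    tendsto_apply_zero_of_exponent_lt hqp hp T (fun n => norm_sub_le_of_le (hx n) hx₀) hx_lim
  have hsmall : Tendsto (fun n => g n (T (x n - x₀))) l (𝓝 0) :=
    squeeze_zero_norm (fun n => (g n).le_of_opNorm_le (hg n) _) (by simpa using hpitt.norm)
  have hattain : g₀ (T x₀) = ‖T‖ := by
    refine tendsto_nhds_unique (hg_lim (T x₀)) ?_
    simpa using hlim.sub hsmall
  have hx₀_norm : ‖x₀‖ = 1 := by
    refine hx₀.antisymm (le_of_mul_le_mul_left ?_ hT_pos)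
    calc ‖T‖ * 1 = g₀ (T x₀) := by rw [mul_one, hattain]
      _ ≤ ‖g₀ (T x₀)‖ := le_abs_self _
      _ ≤ 1 * (‖T‖ * ‖x₀‖) := g₀.le_of_opNorm_le_of_le hg₀ (T.le_opNorm x₀)
      _ = ‖T‖ * ‖x₀‖ := one_mul _
  have hball : ∀ n, ‖x₀ + (x n - x₀)‖ ≤ ‖x₀‖ := by simpa [hx₀_norm] using hx
  refine ⟨x₀, g₀, tendsto_sub_nhds_zero_iff.1 (tendsto_zero_of_norm_add_le hp hball hx_lim), ?_⟩
  refine tendsto_strongDual_of_tendsto_apply hq (hqp.trans_le le_top).ne l hg hg_lim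
    (z := ‖T‖⁻¹ • T x₀) ?_ ?_
  · rw [norm_smul, norm_inv, norm_norm, inv_mul_le_one₀ hT_pos]
    simpa [hx₀_norm] using T.le_opNorm x₀
  · rw [map_smul, hattain, smul_eq_mul, inv_mul_cancel₀ hT_pos.ne']

theorem corollary3p10_general (hq : 1 < q) (hqp : q < p) (hp : p ≠ ∞) (T : lp E p →L[ℝ] lp F q) :
    NormGateauxDifferentiableAt T ↔ NormFrechetDifferentiableAt T := by
  refine ⟨fun hT => normFrechetDifferentiableAt_of_differentiableAt ?_,
    NormFrechetDifferentiableAt.normGateauxDifferentiableAt⟩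
  rcases eq_or_ne T 0 with rfl | hT_ne
  · have := hT.subsingleton_of_zero
    exact (hasFDerivAt_of_subsingleton _ _).differentiableAt
  · refine differentiableAt_opNorm_of_ultrafilter hT fun l hl => ?_
    have hball : ∀ w : Metric.closedBall (0 : lp E p × StrongDual ℝ (lp F q)) 1,
        ‖w.1.1‖ ≤ 1 ∧ ‖w.1.2‖ ≤ 1 := fun w =>
      norm_prod_le_iff.1 (mem_closedBall_zero_iff.1 w.2)
    obtain ⟨x₀, g₀, hx, hg⟩ := exists_tendsto_norming_pair hq hqp hp hT_ne l
      (fun w => (hball w).1) (fun w => (hball w).2) hl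
    exact ⟨(x₀, g₀), hx.prodMk_nhds hg⟩

end Compactness

theorem corollary3p10 (p q : ℝ≥0∞) [Fact (1 ≤ p)] [Fact (1 ≤ q)]
    (hq : 1 < q) (hqp : q < p) (hp : p ≠ ∞)
    (T : lp (fun _ : ℕ => ℝ) p →L[ℝ] lp (fun _ : ℕ => ℝ) q) :
    NormGateauxDifferentiableAt T ↔ NormFrechetDifferentiableAt T :=
  corollary3p10_general hq hqp hp T
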